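/- Let $T\ge 1$ be an integer and let $U_T$ be the set of all pairs $(a,b)\in\mathbb{R}^2$ for which the trinomial $F(z)=z+a z^{1+T}+b z^{1+2T}$ is univalent (injective) in the open unit disk $\{z\in\mathbb{C}:|z|<1\}$. Put $$a^{(0)}=2\,\frac{1+T}{1+2T}\,\sin\frac{\pi}{2+2T},\qquad b^{(0)}=\frac{1}{1+2T}.$$ Then $(a^{(0)},b^{(0)})$ belongs to $U_T$ and is its upper right corner, that is, $x\le a^{(0)}$ and $y\le b^{(0)}$ for all $(x,y)\in U_T$. Moreover $1+x+y>0$ for all $(x,y)\in U_T$, and over $U_T$ the functions $$L_1(x,y)=x,\qquad L_2(x,y)=1+x+y$$ attain their maximum, and the function $$L_3(x,y)=\frac{1-x+y}{1+x+y}$$ attains its minimum, at the point $(a^{(0)},b^{(0)})$. -/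

import Mathlib

noncomputable section

/-- The trinomial `F(z) = z + a z^(1+T) + b z^(1+2T)` with real coefficients `a`, `b`. -/
def trinomial (T : ℕ) (a b : ℝ) (z : ℂ) : ℂ :=
  z + (a : ℂ) * z ^ (1 + T) + (b : ℂ) * z ^ (1 + 2 * T)

/-- The region `U_T` of real pairs `(a, b)` for which the trinomial is univalent in the open
unit disk. The trinomial is a polynomial, hence holomorphic, so univalence is injectivity. -/
def univalenceRegion (T : ℕ) : Set (ℝ × ℝ) :=
  {p | Set.InjOn (trinomial T p.1 p.2) (Metric.ball (0 : ℂ) 1)}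

/-- `a⁽⁰⁾ = 2 (1+T)/(1+2T) sin(π/(2+2T))`. -/
def cornerA (T : ℕ) : ℝ :=
  2 * ((1 + (T : ℝ)) / (1 + 2 * (T : ℝ))) * Real.sin (Real.pi / (2 + 2 * (T : ℝ)))

/-- `b⁽⁰⁾ = 1/(1+2T)`. -/
def cornerB (T : ℕ) : ℝ := 1 / (1 + 2 * (T : ℝ))

/-- The point `(a⁽⁰⁾, b⁽⁰⁾)`. -/
def corner (T : ℕ) : ℝ × ℝ := (cornerA T, cornerB T)

/-- `L₁(x, y) = x`. -/
def L₁ (p : ℝ × ℝ) : ℝ := p.1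

/-- `L₂(x, y) = 1 + x + y`. -/
def L₂ (p : ℝ × ℝ) : ℝ := 1 + p.1 + p.2

/-- `L₃(x, y) = (1 - x + y)/(1 + x + y)`. -/
def L₃ (p : ℝ × ℝ) : ℝ := (1 - p.1 + p.2) / (1 + p.1 + p.2)

end

open Filter Topology Set

/-! Two points of equal modulus are `v e^{is}` and `v e^{-is}`, and the difference of the values of
`F` there is `2iv` times a real quadratic in `v^T` with coefficients `sin s`, `a sin((1+T)s)`, `b
sin((1+2T)s)`. Univalence therefore forces each such quadratic, `0 < s < π`, to be zero-free in the
disk, which is a pair of linear inequalities on its coefficients (`univalent_coeff_bounds`).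

Letting `s → 0` gives `|b| ≤ 1/(1+2T)`, and `s = π/(2+2T)` gives `|a| ≤ (1+b) sin(π/(2+2T))`. Both
are equalities at the corner, and they yield every extremal claim.

For membership of the corner, the inequalities imply injectivity on circles and, in the limit `s →
0`, `F' ≠ 0`; together these give univalence (`injOn_ball_of_injOn_sphere`). The corner satisfies
them by the sharp trigonometric inequality `mul_sin_mul_abs_sin_le`. -/

/-! ### Real quadratics without zeros in the open disk -/

theorem one_le_norm_of_quadratic_root {p q r : ℝ} (hp : 0 < p) (hr : r ≤ p) (hq : |q| ≤ p + r)
    {w : ℂ} (hw : (p : ℂ) + q * w + r * w ^ 2 = 0) : 1 ≤ ‖w‖ := by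
  have hre := congrArg Complex.re hw
  have him := congrArg Complex.im hw
  simp [pow_two] at hre him
  have hn : ‖w‖ ^ 2 = w.re * w.re + w.im * w.im := by
    rw [← Complex.normSq_apply, Complex.normSq_eq_norm_sq]
  by_contra! hlt
  have h0 := norm_nonneg w
  by_cases hy : w.im = 0
  · have hx : ‖w‖ = |w.re| := by
      rw [← Real.sqrt_sq h0, hn, hy, mul_zero, add_zero, Real.sqrt_mul_self_eq_abs]
    rw [hy] at hre
    have h1 : -(|q| * |w.re|) ≤ q * w.re := by rw [← abs_mul]; exact neg_abs_le _
    have h2 : w.re * w.re = |w.re| * |w.re| := (abs_mul_abs_self _).symm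
    rw [← hx] at h1 h2
    have h3 := mul_le_mul_of_nonneg_right hq h0
    have h4 : 0 < (1 - ‖w‖) * (p - r * ‖w‖) := by
      apply mul_pos (by linarith)
      have := mul_le_mul_of_nonneg_right hr h0
      nlinarith
    rw [h2] at hre
    nlinarith
  -- A non-real root comes with its conjugate, so `‖w‖ ^ 2 = p / r`.
  · have h1 : q = -(2 * r * w.re) := by
      apply mul_right_cancel₀ hy
      linarith
    have h2 : p = r * ‖w‖ ^ 2 := by
      rw [h1] at hre
      rw [hn]
      linear_combination hre
    have h3 : ‖w‖ ^ 2 < 1 := by nlinarith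
    have h4 := mul_le_mul_of_nonneg_right hr (sq_nonneg ‖w‖)
    nlinarith

/-- If `r > p`, the product `p / r` of the roots is below 1, so one lies in the disk; if `p ± q + r
< 0`, there is a sign change between 0 and `±1`. -/
theorem quadratic_coeff_bounds {p q r : ℝ} (hp : 0 < p)
    (h : ∀ w : ℂ, ‖w‖ < 1 → (p : ℂ) + q * w + r * w ^ 2 ≠ 0) : r ≤ p ∧ |q| ≤ p + r := by
  constructor
  · by_contra! hr
    have hr0 : (r : ℂ) ≠ 0 := by exact_mod_cast (hp.trans hr).ne'
    obtain ⟨w, hw⟩ := IsAlgClosed.exists_root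
      (Polynomial.C (r : ℂ) * Polynomial.X ^ 2 + Polynomial.C (q : ℂ) * Polynomial.X
        + Polynomial.C (p : ℂ)) (by rw [Polynomial.degree_quadratic hr0]; decide)
    simp at hw
    have hmul : w * (-q / r - w) = p / r := by
      field_simp
      linear_combination -hw
    have hw' : (p : ℂ) + q * (-q / r - w) + r * (-q / r - w) ^ 2 = 0 := by
      field_simp
      linear_combination (r : ℂ) * hw
    have h1 : 1 ≤ ‖w‖ := by
      by_contra! hlt
      exact h w hlt (by linear_combination hw)
    have h2 : 1 ≤ ‖-q / r - w‖ := by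
      by_contra! hlt
      exact h _ hlt hw'
    have h3 := congrArg norm hmul
    rw [norm_mul, norm_div, Complex.norm_real, Complex.norm_real, Real.norm_of_nonneg hp.le,
      Real.norm_of_nonneg (hp.trans hr).le] at h3
    have : p / r < 1 := (div_lt_one (hp.trans hr)).2 hr
    nlinarith
  · have key : ∀ q : ℝ, (∀ w : ℂ, ‖w‖ < 1 → (p : ℂ) + q * w + r * w ^ 2 ≠ 0) → 0 ≤ p + q + r := by
      intro q h
      by_contra! hlt
      have hc : ContinuousOn (fun x : ℝ => p + q * x + r * x ^ 2) (Icc 0 1) := by fun_prop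
      obtain ⟨x, hx, hx0⟩ := intermediate_value_Ioo' zero_le_one hc
        (show (0 : ℝ) ∈ Ioo _ _ from ⟨by simpa using hlt, by simpa using hp⟩)
      refine h x ?_ (by exact_mod_cast hx0)
      rw [Complex.norm_real, Real.norm_of_nonneg hx.1.le]
      exact hx.2
    have h1 := key q h
    have h2 := key (-q) (fun w hw => by
      have := h (-w) (by rwa [norm_neg])
      convert this using 1
      push_cast
      ring)
    rw [abs_le]
    constructor <;> linarith

/-! ### From circles to the disk -/

/-- Among the pairs that violate injectivity, take one minimizing the larger modulus. Local
injectivity keeps such pairs away from the diagonal, so the minimum exists. If the moduli differ,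
the outer point can be pulled inward while the inner one follows by local openness, contradicting
minimality. -/
theorem injOn_ball_of_injOn_sphere {f : ℂ → ℂ} {R : ℝ} (hf : Differentiable ℂ f)
    (hd : ∀ z, ‖z‖ < R → deriv f z ≠ 0)
    (hs : ∀ z w, ‖z‖ < R → ‖z‖ = ‖w‖ → f z = f w → z = w) :
    InjOn f (Metric.ball 0 R) := by
  have hstrict : ∀ z, HasStrictDerivAt f (deriv f z) z := fun z =>
    (hf.analyticAt z).hasStrictDerivAt
  intro z₀ hz₀ w₀ hw₀ h₀
  by_contra hne₀
  rw [mem_ball_zero_iff] at hz₀ hw₀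
  set M := max ‖z₀‖ ‖w₀‖ with hM
  have hMR : M < R := max_lt hz₀ hw₀
  set S : Set (ℂ × ℂ) := {p | max ‖p.1‖ ‖p.2‖ ≤ M ∧ f p.1 = f p.2 ∧ p.1 ≠ p.2} with hS
  have hSc : IsClosed S := by
    rw [← isOpen_compl_iff, isOpen_iff_mem_nhds]
    rintro ⟨z, w⟩ hzw
    by_cases h1 : max ‖z‖ ‖w‖ ≤ M
    · by_cases h2 : f z = f w
      · have h3 : z = w := by
          by_contra h3
          exact hzw ⟨h1, h2, h3⟩
        subst h3
        have hinj := (hstrict z).hasStrictFDerivAt_equiv (hd z ((le_max_left _ _).trans_lt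
          (h1.trans_lt hMR)))
        have hU := hinj.toOpenPartialHomeomorph f |>.open_source.mem_nhds
          hinj.mem_toOpenPartialHomeomorph_source
        filter_upwards [prod_mem_nhds hU hU] with p hp hpS
        exact hpS.2.2 ((hinj.toOpenPartialHomeomorph f).injOn hp.1 hp.2 hpS.2.1)
      · have hc : Continuous f := hf.continuous
        have : IsOpen {p : ℂ × ℂ | f p.1 ≠ f p.2} := isOpen_ne_fun (by fun_prop) (by fun_prop)
        filter_upwards [this.mem_nhds (show (z, w) ∈ _ from h2)] with p hp hpS
        exact hp hpS.2.1
    · have : IsOpen {p : ℂ × ℂ | M < max ‖p.1‖ ‖p.2‖} := isOpen_lt (by fun_prop) (by fun_prop)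
      filter_upwards [this.mem_nhds (show (z, w) ∈ _ from not_le.1 h1)] with p hp hpS
      exact absurd hpS.1 (not_le.2 hp)
  have hScomp : IsCompact S := by
    refine (isCompact_closedBall (0 : ℂ × ℂ) M).of_isClosed_subset hSc ?_
    intro p hp
    rw [mem_closedBall_zero_iff, Prod.norm_def]
    exact hp.1
  obtain ⟨⟨z₁, w₁⟩, hmem, hmin⟩ := hScomp.exists_isMinOn ⟨(z₀, w₀), hM.ge, h₀, hne₀⟩
    (f := fun p : ℂ × ℂ => max ‖p.1‖ ‖p.2‖) (by fun_prop)
  have key : ∀ z w : ℂ, (z, w) ∈ S → (∀ p ∈ S, max ‖z‖ ‖w‖ ≤ max ‖p.1‖ ‖p.2‖) →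
      ‖z‖ < ‖w‖ → False := by
    intro z w hzw hmin hlt
    have hwM : ‖w‖ ≤ M := (le_max_right _ _).trans hzw.1
    have hmap := (hstrict z).map_nhds_eq (hd z (by linarith))
    have hnear : ∀ᶠ u in 𝓝 z, ‖u‖ < (‖z‖ + ‖w‖) / 2 :=
      (continuous_norm.tendsto z).eventually_lt_const (by linarith)
    have himg : f '' {u | ‖u‖ < (‖z‖ + ‖w‖) / 2} ∈ 𝓝 (f w) := by
      rw [← hzw.2.1, ← hmap]
      exact image_mem_map hnear
    have hpath : Tendsto (fun t : ℝ => (t : ℂ) * w) (𝓝[<] 1) (𝓝 w) := by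
      have : Continuous fun t : ℝ => (t : ℂ) * w := by fun_prop
      simpa using (this.tendsto 1).mono_left nhdsWithin_le_nhds
    have e1 := (hf.continuous.tendsto w).comp hpath |>.eventually himg
    have e2 : ∀ᶠ t : ℝ in 𝓝[<] 1, (‖z‖ + ‖w‖) / 2 < ‖(t : ℂ) * w‖ :=
      ((continuous_norm.tendsto w).comp hpath).eventually_const_lt (by linarith)
    have e3 : ∀ᶠ t : ℝ in 𝓝[<] 1, t ∈ Ioo (0 : ℝ) 1 := Ioo_mem_nhdsLT zero_lt_one
    obtain ⟨t, ⟨u, hu, hfu⟩, ht2, ht⟩ := (e1.and (e2.and e3)).exists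
    rw [mem_ofPred_eq] at hu
    have hwpos : 0 < ‖w‖ := (norm_nonneg z).trans_lt hlt
    have hlt' : ‖(t : ℂ) * w‖ < ‖w‖ := by
      rw [norm_mul, Complex.norm_real, Real.norm_of_nonneg ht.1.le]
      exact mul_lt_of_lt_one_left hwpos ht.2
    have hmax : max ‖u‖ ‖(t : ℂ) * w‖ < ‖w‖ := max_lt (by linarith) hlt'
    have hne : u ≠ t * w := by
      rintro rfl
      linarith
    have := hmin (u, t * w) ⟨hmax.le.trans hwM, hfu, hne⟩
    exact absurd ((le_max_right _ _).trans this) (not_le.2 hmax)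
  rcases lt_trichotomy ‖z₁‖ ‖w₁‖ with hlt | heq | hgt
  · exact key _ _ hmem hmin hlt
  · exact hmem.2.2 (hs _ _ (((le_max_left _ _).trans hmem.1).trans_lt hMR) heq hmem.2.1)
  · refine key w₁ z₁ ⟨by rw [max_comm]; exact hmem.1, hmem.2.1.symm, hmem.2.2.symm⟩ ?_ hgt
    intro p hp
    rw [max_comm]
    exact hmin hp

/-- A function vanishing at `0` and nonnegative to the right of it has nonnegative derivative. -/
theorem deriv_nonneg_of_nonneg_right {g : ℝ → ℝ} {g' ε : ℝ} (hε : 0 < ε) (hg : HasDerivAt g g' 0)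
    (h0 : g 0 = 0) (hpos : ∀ s ∈ Ioo 0 ε, 0 ≤ g s) : 0 ≤ g' := by
  have ht := (hasDerivAt_iff_tendsto_slope.1 hg).mono_left
    (nhdsWithin_mono 0 (fun x (hx : x ∈ Ioi (0 : ℝ)) => hx.ne'))
  refine ge_of_tendsto ht ?_
  filter_upwards [Ioo_mem_nhdsGT hε] with s hs
  rw [slope_def_field, h0, sub_zero, sub_zero]
  exact div_nonneg (hpos s hs) hs.1.le

/-! ### The sharp trigonometric inequality -/

theorem abs_sin_nat_mul_le (n : ℕ) (x : ℝ) : |Real.sin (n * x)| ≤ n * |Real.sin x| := by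
  induction n with
  | zero => simp
  | succ n ih =>
    have h : ((n + 1 : ℕ) : ℝ) * x = n * x + x := by push_cast; ring
    rw [h, Real.sin_add]
    calc _ ≤ |Real.sin (n * x)| * |Real.cos x| + |Real.cos (n * x)| * |Real.sin x| := by
          rw [← abs_mul, ← abs_mul]; exact abs_add_le _ _
      _ ≤ |Real.sin (n * x)| * 1 + 1 * |Real.sin x| := by
          gcongr
          · exact Real.abs_cos_le_one _
          · exact Real.abs_cos_le_one _
      _ ≤ _ := by push_cast; linarith

/-- After division by `cos (n δ)` the right side is nondecreasing in `δ`, and at `δ = 0` it equals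
`n sin σ`. -/
theorem mul_sin_mul_cos_le {n σ ε : ℝ} (hn : 1 ≤ n) (hε : n * ε ≤ Real.pi / 2)
    (h : ∀ δ ∈ Ico 0 ε, |Real.cos (n * δ)| ≤ n * Real.sin (σ + δ)) {δ : ℝ} (hδ : δ ∈ Ico 0 ε) :
    n * Real.sin σ * Real.cos (n * δ) ≤
      (n - 1) * Real.sin (σ + δ) + Real.cos (n * δ) * Real.sin (σ + δ - n * δ) := by
  have hcos : ∀ x ∈ Ico 0 ε, 0 < Real.cos (n * x) := by
    intro x hx
    apply Real.cos_pos_of_mem_Ioo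
    have : n * x < n * ε := by gcongr; exact hx.2
    have : 0 ≤ n * x := mul_nonneg (by linarith) hx.1
    constructor <;> linarith [Real.pi_pos]
  set g : ℝ → ℝ := fun x =>
    (n - 1) * Real.sin (σ + x) / Real.cos (n * x) + Real.sin (σ + x - n * x) with hg
  have hder : ∀ x ∈ Ico 0 ε, HasDerivAt g
      ((n - 1) * Real.sin (n * x) * (n * Real.sin (σ + x) -
        Real.cos (n * x) * Real.sin (σ + x - n * x)) / Real.cos (n * x) ^ 2) x := by
    intro x hx
    have hl : HasDerivAt (fun x : ℝ => σ + x) 1 x := (hasDerivAt_id x).const_add σ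
    have hm : HasDerivAt (fun x : ℝ => n * x) n x := by
      simpa using (hasDerivAt_id x).const_mul n
    have hc := (hcos x hx).ne'
    refine (((hl.sin.const_mul (n - 1)).div hm.cos hc).add (hl.fun_sub hm).sin).congr_deriv ?_
    rw [Real.sin_sub, Real.cos_sub]
    field_simp
    linear_combination (1 - n) * Real.cos (σ + x) * Real.cos (n * x) *
      (Real.sin_sq_add_cos_sq (n * x))
  have hmono : MonotoneOn g (Ico 0 ε) := by
    refine monotoneOn_of_deriv_nonneg (convex_Ico 0 ε)
      (fun x hx => (hder x hx).continuousAt.continuousWithinAt)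
      (fun x hx => (hder x (interior_subset hx)).differentiableAt.differentiableWithinAt) ?_
    intro x hx
    replace hx := interior_subset hx
    rw [(hder x hx).deriv]
    have hx0 : 0 ≤ n * x := mul_nonneg (by linarith) hx.1
    have hxε : n * x < n * ε := by gcongr; exact hx.2
    have hs : 0 ≤ Real.sin (n * x) :=
      Real.sin_nonneg_of_nonneg_of_le_pi hx0 (by linarith [Real.pi_pos])
    have h1 : Real.cos (n * x) * Real.sin (σ + x - n * x) ≤ |Real.cos (n * x)| := by
      rw [abs_of_pos (hcos x hx)]
      exact mul_le_of_le_one_right (hcos x hx).le (Real.sin_le_one _)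
    have h2 := h x hx
    refine div_nonneg (mul_nonneg (mul_nonneg (by linarith) hs) (by linarith)) (sq_nonneg _)
  have hle := hmono ⟨le_rfl, hδ.1.trans_lt hδ.2⟩ hδ hδ.1
  have hc := hcos δ hδ
  simp only [hg, mul_zero, add_zero, sub_zero, Real.cos_zero, div_one] at hle
  have := mul_le_mul_of_nonneg_right hle hc.le
  simp only [add_mul, div_mul_cancel₀ _ hc.ne'] at this
  linarith

theorem lobe_center_bounds {n k : ℕ} (hk : k < n) :
    Real.pi / (2 * n) ≤ (k + 1 / 2) * Real.pi / n ∧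
      (k + 1 / 2) * Real.pi / n ≤ Real.pi - Real.pi / (2 * n) := by
  have hn : (0 : ℝ) < n := by exact_mod_cast (Nat.zero_le k).trans_lt hk
  have hk' : (k : ℝ) + 1 ≤ n := by exact_mod_cast hk
  have hpi := Real.pi_pos
  have hk0 : (0 : ℝ) ≤ k := Nat.cast_nonneg k
  have e1 : (k + 1 / 2) * Real.pi / n = k * Real.pi / n + Real.pi / (2 * n) := by
    field_simp
  have e2 : (k + 1) * Real.pi / n ≤ Real.pi := by
    rw [div_le_iff₀ hn]
    nlinarith
  have e3 : (k + 1) * Real.pi / n = (k + 1 / 2) * Real.pi / n + Real.pi / (2 * n) := by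
    field_simp
    ring
  constructor
  · rw [e1]
    have : 0 ≤ k * Real.pi / n := by positivity
    linarith
  · linarith

theorem sin_le_sin_lobe_center {n k : ℕ} (hk : k < n) :
    Real.sin (Real.pi / (2 * n)) ≤ Real.sin ((k + 1 / 2) * Real.pi / n) := by
  obtain ⟨h1, h2⟩ := lobe_center_bounds hk
  have hn : (0 : ℝ) < n := by exact_mod_cast (Nat.zero_le k).trans_lt hk
  have h0 : 0 < Real.pi / (2 * n) := by positivity
  rcases le_total ((k + 1 / 2) * Real.pi / n) (Real.pi / 2) with h | h
  · exact Real.sin_le_sin_of_le_of_le_pi_div_two (by linarith [Real.pi_pos]) h h1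
  · rw [← Real.sin_pi_sub ((k + 1 / 2) * Real.pi / n)]
    exact Real.sin_le_sin_of_le_of_le_pi_div_two (by linarith [Real.pi_pos]) (by linarith)
      (by linarith)

theorem lobe_right_half {n k : ℕ} (hk : k < n) {δ : ℝ} (hδ : δ ∈ Ico 0 (Real.pi / (2 * n))) :
    n * Real.sin ((k + 1 / 2) * Real.pi / n) * Real.cos (n * δ) ≤
      (n - 1) * Real.sin ((k + 1 / 2) * Real.pi / n + δ) +
        Real.cos (n * δ) * Real.sin ((k + 1 / 2) * Real.pi / n + δ - n * δ) := by
  have hn1 : (1 : ℝ) ≤ n := by exact_mod_cast (Nat.zero_le k).trans_lt hk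
  have hn : (0 : ℝ) < n := by linarith
  have h0 : 0 < Real.pi / (2 * n) := by have := Real.pi_pos; positivity
  obtain ⟨h1, h2⟩ := lobe_center_bounds hk
  refine mul_sin_mul_cos_le hn1 (le_of_eq (by field_simp)) ?_ hδ
  intro x hx
  have hs : 0 ≤ Real.sin ((k + 1 / 2) * Real.pi / n + x) :=
    Real.sin_nonneg_of_nonneg_of_le_pi (by linarith [hx.1]) (by linarith [hx.2])
  have hle := abs_sin_nat_mul_le n ((k + 1 / 2) * Real.pi / n + x)
  have e : n * ((k + 1 / 2) * Real.pi / n + x) = n * x + Real.pi / 2 + k * Real.pi := by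
    field_simp
    ring
  rw [e, Real.sin_add_nat_mul_pi, Real.sin_add_pi_div_two, abs_mul, abs_pow, abs_neg, abs_one,
    one_pow, one_mul, abs_of_nonneg hs] at hle
  exact hle

/-- Zeros of `sin (n s)` cut `(0, π)` into `n` lobes. On each, the bound holds with `sin σ` at the
lobe center `σ` in place of `sin (π / (2n))`, which is the least of these values. -/
theorem mul_sin_mul_abs_sin_le {n : ℕ} (hn0 : 0 < n) {s : ℝ} (hs : s ∈ Ioo 0 Real.pi) :
    n * Real.sin (Real.pi / (2 * n)) * |Real.sin (n * s)| ≤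
      (n - 1) * Real.sin s + Real.sin (n * s) * Real.cos ((n - 1) * s) := by
  have hpi := Real.pi_pos
  have hn : (0 : ℝ) < n := by exact_mod_cast hn0
  have hn1 : (1 : ℝ) ≤ n := by exact_mod_cast hn0
  have hspos : 0 < Real.sin s := Real.sin_pos_of_mem_Ioo hs
  have hnonneg : 0 ≤ n * s / Real.pi := by have := hs.1; positivity
  obtain ⟨k, hk⟩ : ∃ k, k = ⌊n * s / Real.pi⌋₊ := ⟨_, rfl⟩
  have hk1 : k * Real.pi ≤ n * s := by
    rw [← le_div_iff₀ hpi, hk]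
    exact Nat.floor_le hnonneg
  have hk2 : n * s < (k + 1) * Real.pi := by
    rw [← div_lt_iff₀ hpi, hk]
    exact Nat.lt_floor_add_one _
  have hkn : k < n := by
    rw [hk, Nat.floor_lt hnonneg, div_lt_iff₀ hpi]
    exact mul_lt_mul_of_pos_left hs.2 hn
  set σ := (k + 1 / 2) * Real.pi / n with hσ
  obtain ⟨δ, hδ⟩ : ∃ δ, δ = s - σ := ⟨_, rfl⟩
  have hsσ : s = σ + δ := by rw [hδ]; ring
  have hnσ : n * σ = (k + 1 / 2) * Real.pi := by rw [hσ]; field_simp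
  have hns : n * s = n * δ + Real.pi / 2 + k * Real.pi := by
    rw [hsσ, mul_add, hnσ]
    ring
  have hsin : Real.sin (n * s) = (-1) ^ k * Real.cos (n * δ) := by
    rw [hns, Real.sin_add_nat_mul_pi, Real.sin_add_pi_div_two]
  have hcos : Real.cos ((n - 1) * s) = (-1) ^ k * Real.sin (s - n * δ) := by
    have : (n - 1) * s = Real.pi / 2 - (s - n * δ) + k * Real.pi := by
      rw [sub_mul, hns]
      ring
    rw [this, Real.cos_add_nat_mul_pi, Real.cos_pi_div_two_sub]
  have hsq : ((-1 : ℝ) ^ k) * (-1) ^ k = 1 := by rw [← mul_pow]; simp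
  have hprod : Real.sin (n * s) * Real.cos ((n - 1) * s) =
      Real.cos (n * δ) * Real.sin (s - n * δ) := by
    rw [hsin, hcos]
    linear_combination Real.cos (n * δ) * Real.sin (s - n * δ) * hsq
  have hl : -(Real.pi / 2) ≤ n * δ := by linarith
  have hr : n * δ < Real.pi / 2 := by linarith
  have hc0 : 0 ≤ Real.cos (n * δ) := Real.cos_nonneg_of_mem_Icc ⟨hl, hr.le⟩
  have habs : |Real.sin (n * s)| = Real.cos (n * δ) := by
    rw [hsin, abs_mul, abs_pow, abs_neg, abs_one, one_pow, one_mul, abs_of_nonneg hc0]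
  rw [hprod, habs]
  have hcenter : n * Real.sin (Real.pi / (2 * n)) * Real.cos (n * δ) ≤
      n * Real.sin σ * Real.cos (n * δ) := by
    gcongr
    exact sin_le_sin_lobe_center hkn
  refine hcenter.trans ?_
  have hwidth : n * (Real.pi / (2 * n)) = Real.pi / 2 := by field_simp
  rcases le_or_gt 0 δ with h0 | h0
  · have := lobe_right_half hkn (δ := δ) ⟨h0, by
      apply lt_of_mul_lt_mul_left _ hn.le
      linarith⟩
    rwa [← hσ, ← hsσ] at this
  · rcases hl.eq_or_lt with heq | hlt
    · rw [← heq, Real.cos_neg, Real.cos_pi_div_two]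
      simp only [mul_zero, zero_mul, add_zero]
      exact mul_nonneg (by linarith) hspos.le
    -- The reflection `s ↦ π - s` carries the left half of lobe `k` to the right half of lobe `n - 1
    -- - k`.
    · have hk' : n - 1 - k < n := by omega
      have hσ' : ((n - 1 - k : ℕ) + 1 / 2) * Real.pi / n = Real.pi - σ := by
        rw [Nat.cast_sub (by omega), Nat.cast_sub (by omega), hσ]
        field_simp
        push_cast
        ring
      have := lobe_right_half hk' (δ := -δ) ⟨by linarith, by
        apply lt_of_mul_lt_mul_left _ hn.le
        linarith⟩
      rw [hσ', Real.sin_pi_sub, mul_neg, Real.cos_neg,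
        show Real.pi - σ + -δ = Real.pi - s by rw [hsσ]; ring,
        show Real.pi - s - -(n * δ) = Real.pi - (s - n * δ) by ring, Real.sin_pi_sub,
        Real.sin_pi_sub] at this
      exact this

/-! ### Necessary conditions for univalence -/

theorem rotation_pow_sub (v : ℂ) (s : ℝ) (m : ℕ) :
    (v * Complex.exp (s * Complex.I)) ^ m - (v * Complex.exp (-(s * Complex.I))) ^ m =
      2 * Complex.I * v ^ m * (Real.sin (m * s) : ℝ) := by
  have h1 : (m : ℂ) * (s * Complex.I) = (m * s) * Complex.I := by ring
  have h2 : (m : ℂ) * -(s * Complex.I) = (-(m * s)) * Complex.I := by ring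
  rw [mul_pow, mul_pow, ← Complex.exp_nat_mul, ← Complex.exp_nat_mul, h1, h2, Complex.exp_mul_I,
    Complex.exp_mul_I, Complex.cos_neg, Complex.sin_neg]
  push_cast
  ring

theorem trinomial_rotation_sub (T : ℕ) (a b : ℝ) (v : ℂ) (s : ℝ) :
    trinomial T a b (v * Complex.exp (s * Complex.I)) -
        trinomial T a b (v * Complex.exp (-(s * Complex.I))) =
      2 * Complex.I * v * ((Real.sin s : ℝ) + (a * Real.sin ((1 + T) * s) : ℝ) * v ^ T +
        (b * Real.sin ((1 + 2 * T) * s) : ℝ) * (v ^ T) ^ 2) := by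
  have h0 := rotation_pow_sub v s 1
  have h1 := rotation_pow_sub v s (1 + T)
  have h2 := rotation_pow_sub v s (1 + 2 * T)
  simp only [pow_one, Nat.cast_one, one_mul] at h0
  unfold trinomial
  push_cast at h0 h1 h2 ⊢
  linear_combination h0 + (a : ℂ) * h1 + (b : ℂ) * h2

theorem univalent_coeff_bounds {T : ℕ} (hT : 1 ≤ T) {a b : ℝ}
    (h : InjOn (trinomial T a b) (Metric.ball 0 1)) {s : ℝ} (hs : s ∈ Ioo 0 Real.pi) :
    b * Real.sin ((1 + 2 * T) * s) ≤ Real.sin s ∧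
      |a * Real.sin ((1 + T) * s)| ≤ Real.sin s + b * Real.sin ((1 + 2 * T) * s) := by
  have hspos := Real.sin_pos_of_mem_Ioo hs
  refine quadratic_coeff_bounds hspos ?_
  intro w hw hw0
  obtain ⟨v, hv⟩ := IsAlgClosed.exists_pow_nat_eq w hT
  have hv1 : ‖v‖ < 1 := by
    rw [← hv, norm_pow] at hw
    exact (pow_lt_one_iff_of_nonneg (norm_nonneg v) (by omega)).1 hw
  have hv0 : v ≠ 0 := by
    rintro rfl
    rw [zero_pow (by omega)] at hv
    rw [← hv] at hw0
    simp only [mul_zero, add_zero, ne_eq, OfNat.ofNat_ne_zero, not_false_eq_true, zero_pow] at hw0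
    exact hspos.ne' (by exact_mod_cast hw0)
  have hsub := trinomial_rotation_sub T a b v s
  rw [hv, hw0, mul_zero, sub_eq_zero] at hsub
  have hmem : ∀ t : ℝ, v * Complex.exp (t * Complex.I) ∈ Metric.ball (0 : ℂ) 1 := by
    intro t
    rw [mem_ball_zero_iff, norm_mul, Complex.norm_exp_ofReal_mul_I, mul_one]
    exact hv1
  have hmem' := hmem (-s)
  push_cast at hmem'
  rw [neg_mul] at hmem'
  have heq := h (hmem s) hmem' hsub
  have hdiff := rotation_pow_sub v s 1
  rw [heq, sub_self, pow_one, Nat.cast_one, one_mul] at hdiff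
  have : (Real.sin s : ℂ) ≠ 0 := by exact_mod_cast hspos.ne'
  exact mul_ne_zero (mul_ne_zero (mul_ne_zero two_ne_zero Complex.I_ne_zero) hv0) this hdiff.symm

/-- Both sides vanish at `s = 0`, so their slopes there compare. -/
theorem abs_le_one_of_forall_mul_sin_le {c m : ℝ}
    (h : ∀ s ∈ Ioo 0 Real.pi, |c * Real.sin (m * s)| ≤ Real.sin s) : |c * m| ≤ 1 := by
  have hd : ∀ d : ℝ, HasDerivAt (fun s => Real.sin s - d * Real.sin (m * s)) (1 - d * m) 0 := by
    intro d
    have hm : HasDerivAt (fun x : ℝ => m * x) m 0 := by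
      simpa using (hasDerivAt_id (0 : ℝ)).const_mul m
    exact ((Real.hasDerivAt_sin 0).fun_sub (hm.sin.const_mul d)).congr_deriv (by simp)
  have h1 := deriv_nonneg_of_nonneg_right Real.pi_pos (hd c) (by simp)
    (fun s hs => by have := (abs_le.1 (h s hs)).2; linarith)
  have h2 := deriv_nonneg_of_nonneg_right Real.pi_pos (hd (-c)) (by simp)
    (fun s hs => by have := (abs_le.1 (h s hs)).1; linarith)
  rw [abs_le]
  constructor <;> linarith

theorem univalent_abs_leading_le {T : ℕ} (hT : 1 ≤ T) {a b : ℝ}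
    (h : InjOn (trinomial T a b) (Metric.ball 0 1)) : |b| * (1 + 2 * T) ≤ 1 := by
  have := abs_le_one_of_forall_mul_sin_le (c := b) (m := 1 + 2 * T) (fun s hs => by
    obtain ⟨h1, h2⟩ := univalent_coeff_bounds hT h hs
    have := abs_nonneg (a * Real.sin ((1 + T) * s))
    rw [abs_le]
    constructor <;> linarith)
  rwa [abs_mul, abs_of_nonneg (by positivity : (0 : ℝ) ≤ 1 + 2 * T)] at this

theorem univalent_abs_middle_le {T : ℕ} (hT : 1 ≤ T) {a b : ℝ}
    (h : InjOn (trinomial T a b) (Metric.ball 0 1)) :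
    |a| ≤ (1 + b) * Real.sin (Real.pi / (2 + 2 * T)) := by
  have hpi := Real.pi_pos
  have hT0 : (0 : ℝ) ≤ T := Nat.cast_nonneg T
  have h2 := (univalent_coeff_bounds hT h (s := Real.pi / (2 + 2 * T))
    ⟨by positivity, div_lt_self hpi (by linarith)⟩).2
  have e1 : (1 + T) * (Real.pi / (2 + 2 * T)) = Real.pi / 2 := by field_simp
  have e2 : (1 + 2 * T) * (Real.pi / (2 + 2 * T)) = Real.pi - Real.pi / (2 + 2 * T) := by
    field_simp
    ring
  rw [e1, e2, Real.sin_pi_div_two, Real.sin_pi_sub, mul_one] at h2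
  linarith

/-! ### Univalence at the corner -/

theorem corner_coeff_bounds (T : ℕ) {s : ℝ} (hs : s ∈ Ioo 0 Real.pi) :
    |cornerB T * Real.sin ((1 + 2 * T) * s)| ≤ Real.sin s ∧
      |cornerA T * Real.sin ((1 + T) * s)| ≤
        Real.sin s + cornerB T * Real.sin ((1 + 2 * T) * s) := by
  have hpi := Real.pi_pos
  have hT0 : (0 : ℝ) ≤ T := Nat.cast_nonneg T
  have hspos := Real.sin_pos_of_mem_Ioo hs
  have hm : (0 : ℝ) < 1 + 2 * T := by positivity
  constructor
  · have := abs_sin_nat_mul_le (1 + 2 * T) s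
    push_cast at this
    rw [abs_of_pos hspos] at this
    rw [cornerB, abs_mul, abs_of_pos (by positivity), one_div, inv_mul_le_iff₀ hm]
    exact this
  · have hmain := mul_sin_mul_abs_sin_le (Nat.succ_pos T) hs
    push_cast at hmain
    have hsin : 0 ≤ Real.sin (Real.pi / (2 + 2 * T)) :=
      Real.sin_nonneg_of_nonneg_of_le_pi (by positivity) (div_le_self hpi.le (by linarith))
    have hA : 0 ≤ cornerA T := by unfold cornerA; positivity
    rw [abs_mul, abs_of_nonneg hA]
    -- With `n = T + 1` this turns the claim into `2 / (1 + 2T)` times the sharp inequality.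
    have e : Real.sin ((1 + 2 * T) * s) =
        2 * (Real.sin ((T + 1) * s) * Real.cos ((T + 1 - 1) * s)) - Real.sin s := by
      have e1 : (1 + 2 * T) * s = (T + 1) * s + (T + 1 - 1) * s := by ring
      have e2 : Real.sin s = Real.sin ((T + 1) * s - (T + 1 - 1) * s) := by congr 1; ring
      rw [e1, e2, Real.sin_add, Real.sin_sub]
      ring
    rw [e]
    unfold cornerA cornerB
    rw [show (1 + (T : ℝ)) * s = (T + 1) * s by ring,
      show (2 + 2 * (T : ℝ)) = 2 * (T + 1) by ring]
    have := mul_le_mul_of_nonneg_left hmain (by positivity : (0 : ℝ) ≤ 2 / (1 + 2 * T))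
    refine le_trans (le_of_eq ?_) (this.trans (le_of_eq ?_))
    · ring
    · generalize Real.sin ((T + 1) * s) * Real.cos ((T + 1 - 1) * s) = x
      field_simp
      ring

theorem trinomial_injOn_sphere_of_coeff_bounds {T : ℕ} (hT : 1 ≤ T) {a b : ℝ}
    (hb : ∀ s ∈ Ioo 0 Real.pi, b * Real.sin ((1 + 2 * T) * s) ≤ Real.sin s)
    (ha : ∀ s ∈ Ioo 0 Real.pi,
      |a * Real.sin ((1 + T) * s)| ≤ Real.sin s + b * Real.sin ((1 + 2 * T) * s))
    {z w : ℂ} (hz : ‖z‖ < 1) (hzw : ‖z‖ = ‖w‖) (heq : trinomial T a b z = trinomial T a b w) :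
    z = w := by
  by_contra hne
  have hw0 : w ≠ 0 := by
    rintro rfl
    exact hne (norm_eq_zero.1 (by rw [hzw, norm_zero]))
  have hz0 : z ≠ 0 := by
    rintro rfl
    exact hw0 (norm_eq_zero.1 (by rw [← hzw, norm_zero]))
  -- `w * u` is the midpoint direction: `z` and `w` are its rotations by `±arg u`. The sign of `u`
  -- is chosen to put `arg u` in `(0, π)`.
  obtain ⟨u, hu⟩ := IsAlgClosed.exists_pow_nat_eq (z / w) two_pos
  have hu1 : ‖u‖ = 1 := by
    have := congrArg norm hu
    rw [norm_pow, norm_div, hzw, div_self (norm_ne_zero_iff.2 hw0)] at this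
    exact (pow_eq_one_iff_of_nonneg (norm_nonneg u) two_ne_zero).1 this
  wlog him : 0 ≤ u.im generalizing u
  · refine this (-u) (by rw [neg_sq, hu]) (by rw [norm_neg, hu1]) ?_
    rw [Complex.neg_im]
    linarith
  have hexp : Complex.exp (u.arg * Complex.I) = u := by
    have := Complex.norm_mul_exp_arg_mul_I u
    rwa [hu1, Complex.ofReal_one, one_mul] at this
  have husq : u ^ 2 ≠ 1 := by
    rw [hu, ne_eq, div_eq_one_iff_eq hw0]
    exact hne
  have harg : u.arg ∈ Ioo 0 Real.pi := by
    refine ⟨lt_of_le_of_ne (Complex.arg_nonneg_iff.2 him) ?_,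
      lt_of_le_of_ne (Complex.arg_le_pi u) ?_⟩
    · intro h
      apply husq
      rw [← hexp, ← h]
      simp
    · intro h
      apply husq
      rw [← hexp, h, Complex.exp_pi_mul_I]
      norm_num
  have hu0 : u ≠ 0 := by
    rintro rfl
    simp at hu1
  have hsub := trinomial_rotation_sub T a b (w * u) u.arg
  have e1 : w * u * Complex.exp (u.arg * Complex.I) = z := by
    rw [hexp, mul_assoc, ← pow_two, hu, mul_div_cancel₀ _ hw0]
  have e2 : w * u * Complex.exp (-(u.arg * Complex.I)) = w := by
    rw [Complex.exp_neg, hexp, mul_assoc, mul_inv_cancel₀ hu0, mul_one]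
  rw [e1, e2, heq, sub_self] at hsub
  have hroot := (mul_eq_zero.1 hsub.symm).resolve_left
    (mul_ne_zero (mul_ne_zero two_ne_zero Complex.I_ne_zero) (mul_ne_zero hw0 hu0))
  have hge := one_le_norm_of_quadratic_root (Real.sin_pos_of_mem_Ioo harg) (hb _ harg)
    (ha _ harg) hroot
  rw [norm_pow, norm_mul, hu1, mul_one, ← hzw] at hge
  exact absurd hge (not_le.2 (pow_lt_one₀ (norm_nonneg z) hz (by omega)))

theorem hasDerivAt_trinomial (T : ℕ) (a b : ℝ) (z : ℂ) :
    HasDerivAt (trinomial T a b)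
      (((1 : ℝ) : ℂ) + (a * (1 + T) : ℝ) * z ^ T + (b * (1 + 2 * T) : ℝ) * (z ^ T) ^ 2) z := by
  have := ((hasDerivAt_id z).add ((hasDerivAt_pow (1 + T) z).const_mul (a : ℂ))).add
    ((hasDerivAt_pow (1 + 2 * T) z).const_mul (b : ℂ))
  refine this.congr_deriv ?_
  simp only [Nat.add_sub_cancel_left]
  push_cast
  ring

theorem trinomial_injOn_of_coeff_bounds {T : ℕ} (hT : 1 ≤ T) {a b : ℝ}
    (hb : ∀ s ∈ Ioo 0 Real.pi, |b * Real.sin ((1 + 2 * T) * s)| ≤ Real.sin s)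
    (ha : ∀ s ∈ Ioo 0 Real.pi,
      |a * Real.sin ((1 + T) * s)| ≤ Real.sin s + b * Real.sin ((1 + 2 * T) * s)) :
    InjOn (trinomial T a b) (Metric.ball 0 1) := by
  refine injOn_ball_of_injOn_sphere (fun z => (hasDerivAt_trinomial T a b z).differentiableAt) ?_
    (fun z w hz hzw heq => trinomial_injOn_sphere_of_coeff_bounds hT
      (fun s hs => (le_abs_self _).trans (hb s hs)) ha hz hzw heq)
  intro z hz hz0
  rw [(hasDerivAt_trinomial T a b z).deriv] at hz0
  have hd : ∀ d : ℝ, HasDerivAt (fun s => Real.sin s + b * Real.sin ((1 + 2 * T) * s) -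
      d * Real.sin ((1 + T) * s)) (1 + b * (1 + 2 * T) - d * (1 + T)) 0 := by
    intro d
    have hm : ∀ m : ℝ, HasDerivAt (fun x : ℝ => m * x) m 0 := fun m => by
      simpa using (hasDerivAt_id (0 : ℝ)).const_mul m
    exact (((Real.hasDerivAt_sin 0).fun_add ((hm (1 + 2 * T)).sin.const_mul b)).fun_sub
      ((hm (1 + T)).sin.const_mul d)).congr_deriv (by simp)
  have h1 := deriv_nonneg_of_nonneg_right Real.pi_pos (hd a) (by simp)
    (fun s hs => by have := (abs_le.1 (ha s hs)).2; linarith)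
  have h2 := deriv_nonneg_of_nonneg_right Real.pi_pos (hd (-a)) (by simp)
    (fun s hs => by have := (abs_le.1 (ha s hs)).1; linarith)
  have hge := one_le_norm_of_quadratic_root one_pos
    (abs_le.1 (abs_le_one_of_forall_mul_sin_le hb)).2
    (abs_le.2 ⟨by linarith, by linarith⟩) hz0
  rw [norm_pow] at hge
  exact absurd hge (not_le.2 (pow_lt_one₀ (norm_nonneg z) hz (by omega)))

/-! ### Extremality of the corner -/

theorem theorem1 (T : ℕ) (hT : 1 ≤ T) :
    -- the corner is a point of the region
    corner T ∈ univalenceRegion T ∧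
    -- and it is the upper right corner of the region
    (∀ p ∈ univalenceRegion T, p.1 ≤ (corner T).1 ∧ p.2 ≤ (corner T).2) ∧
    -- the quotient defining `L₃` makes sense on the whole region
    (∀ p ∈ univalenceRegion T, 0 < 1 + p.1 + p.2) ∧
    IsMaxOn L₁ (univalenceRegion T) (corner T) ∧
    IsMaxOn L₂ (univalenceRegion T) (corner T) ∧
    IsMinOn L₃ (univalenceRegion T) (corner T) := by
  have hpi := Real.pi_pos
  have hT1 : (1 : ℝ) ≤ T := by exact_mod_cast hT
  have hm : (0 : ℝ) < 1 + 2 * T := by positivity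
  obtain ⟨c, hc⟩ : ∃ c, c = Real.sin (Real.pi / (2 + 2 * T)) := ⟨_, rfl⟩
  have hc0 : 0 < c := by
    rw [hc]
    exact Real.sin_pos_of_mem_Ioo ⟨by positivity, div_lt_self hpi (by linarith)⟩
  have hc1 : c < 1 := by
    rw [hc, ← Real.sin_pi_div_two]
    refine Real.sin_lt_sin_of_lt_of_le_pi_div_two ?_ le_rfl ?_
    · have : 0 < Real.pi / (2 + 2 * (T : ℝ)) := by positivity
      linarith
    · exact div_lt_div_of_pos_left hpi two_pos (by linarith)
  have hcorner : cornerA T = (1 + cornerB T) * c := by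
    rw [cornerA, cornerB, hc]
    field_simp
    ring
  have hmem : corner T ∈ univalenceRegion T :=
    trinomial_injOn_of_coeff_bounds hT (fun s hs => (corner_coeff_bounds T hs).1)
      (fun s hs => (corner_coeff_bounds T hs).2)
  have hB : ∀ p ∈ univalenceRegion T, p.2 ≤ cornerB T ∧ -1 < p.2 := by
    intro p hp
    have h := univalent_abs_leading_le hT hp
    have h1 : |p.2| ≤ cornerB T := by rwa [cornerB, le_div_iff₀ hm]
    have h2 : cornerB T < 1 := by
      rw [cornerB, div_lt_one hm]
      linarith
    exact ⟨(le_abs_self _).trans h1, by linarith [neg_abs_le p.2]⟩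
  have hA : ∀ p ∈ univalenceRegion T, |p.1| ≤ (1 + p.2) * c := by
    intro p hp
    rw [hc]
    exact univalent_abs_middle_le hT hp
  have hupper : ∀ p ∈ univalenceRegion T, p.1 ≤ cornerA T ∧ p.2 ≤ cornerB T := by
    intro p hp
    refine ⟨?_, (hB p hp).1⟩
    rw [hcorner]
    refine ((le_abs_self _).trans (hA p hp)).trans ?_
    gcongr
    exact (hB p hp).1
  have hpos : ∀ p ∈ univalenceRegion T, 0 < 1 + p.1 + p.2 := by
    intro p hp
    have h1 := (abs_le.1 (hA p hp)).1
    have h2 := (hB p hp).2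
    nlinarith
  refine ⟨hmem, hupper, hpos, fun p hp => (hupper p hp).1, fun p hp => ?_, fun p hp => ?_⟩
  · have := hupper p hp
    change 1 + p.1 + p.2 ≤ 1 + cornerA T + cornerB T
    linarith
  -- With `t = x / (1 + y)`, `L₃ = (1 - t) / (1 + t)` decreases in `t`, and `t ≤ c` with equality at
  -- the corner.
  · change (1 - cornerA T + cornerB T) / (1 + cornerA T + cornerB T) ≤
      (1 - p.1 + p.2) / (1 + p.1 + p.2)
    have hposc : 0 < 1 + cornerA T + cornerB T := hpos _ hmem
    have h0 : 0 < 1 + cornerB T := by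
      rw [cornerB]
      positivity
    have h1 := mul_le_mul_of_nonneg_right ((le_abs_self _).trans (hA p hp)) h0.le
    rw [div_le_div_iff₀ hposc (hpos p hp), hcorner]
    linarith
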